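/- **Notation.** Let $H_0=\begin{pmatrix}-1&2\\0&1\end{pmatrix}$, $H_1=\begin{pmatrix}-1&0\\0&1\end{pmatrix}$, $H_\infty=\begin{pmatrix}1&0\\2&-1\end{pmatrix}$ act on $\mathbb R\cup\{\infty\}$ by Möbius transformations $x\mapsto\frac{ax+b}{cx+d}$, and let $I_0=[1,\infty]$, $I_1=[-\infty,0]$, $I_\infty=[0,1]$ (with $-\infty=\infty$). For $x\in\mathbb R\cup\{\infty\}$ write $x=[\alpha_1,\alpha_2,\dots]_\Delta$ (a $\Delta$-expression of $x$) if $\alpha_n\in\{0,1,\infty\}$, $\alpha_n\ne\alpha_{n+1}$ and $(H_{\alpha_1}\cdots H_{\alpha_{n-1}})^{-1}\cdot x\in I_{\alpha_n}$ for all $n\ge1$. Let $\sigma_J$ be the permutation of $\{0,1,\infty\}$ that swaps $0$ and $\infty$ and fixes $1$. For $x=[\infty,\alpha_2,\alpha_3,\dots]_\Delta\in(0,1]$ put $m=\min\{j\ge1:\alpha_{j+1}=0\}$ and $$\psi_J(x)=[\sigma_J(0),\sigma_J(\alpha_{m+2}),\sigma_J(\alpha_{m+3}),\dots]_\Delta ,$$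 and put $\psi_J(0)=0$. The even continued fraction map $T$ on $[0,1]$ sends $x>0$ to the distance from $1/x$ to the nearest even integer, and $T(0)=0$. The even continued fraction of an irrational $x\in[0,1]$ is $$x=\cfrac{1}{b_1+\cfrac{\epsilon_1}{b_2+\cfrac{\epsilon_2}{\ddots}}},$$ where $b_n$ is the even integer nearest to $1/T^{n-1}(x)$ and $\epsilon_n\in\{1,-1\}$ is determined by $1/T^{n-1}(x)=b_n+\epsilon_nT^n(x)$; its $n$-th convergent is the truncation ending in $b_n$, and its $0$-th convergent is $0$. A best $(0,\infty)$-rational approximation of an irrational $x$ is a reduced fraction $p/q$, $q>0$, of the form even/odd or odd/even, such that $|qx-p|<|bx-a|$ for every other reduced fraction $a/b$ of the form even/odd or odd/even with $0<b\le q$; let $\mathscr B^{(0,\infty)}(x)$ be the set of these. For irrational $x\in[0,1]$ and $i\ge0$ let $(\psi_J)_x^{-i}$ be the inverse of $(\psi_J)^i$ restricted to the maximal closed interval $I_x^{(i)}\subset[0,1]$ containing $x$ on which $(\psi_J)^i$ is continuous and injective. **Statement.** (1) The map $\psi_J$ is well defined: every $x\in(0,1]$ has a $\Delta$-expression with first letter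 $\infty$; for each such expression $m$ exists, the sequence $\sigma_J(0),\sigma_J(\alpha_{m+2}),\dots$ is a $\Delta$-expression of exactly one point, and this point does not depend on the chosen expression of $x$. Moreover $\psi_J=T$ on $[0,1]$. (2) For every irrational $x\in[0,1]$ and every $i\ge0$, the interval $I_x^{(i)}$ exists (there is a largest one), $(\psi_J)^i$ maps it bijectively onto $[0,1]$, and $(\psi_J)_x^{-i}(0)$ is the $i$-th convergent of the even continued fraction of $x$. Furthermore $$\mathscr B^{(0,\infty)}(x)=\{(\psi_J)_x^{-i}(0)\;:\;i\ge0\},$$ that is, the best $(0,\infty)$-rational approximations of $x$ are exactly its even continued fraction convergents (the theorem of Short and Walker). -/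

import Mathlib

open Set

noncomputable section

namespace DeltaCF

/-! ### Parity classes of rationals and best approximations -/

/-- The three letters `0`, `1`, `∞`. -/
inductive Letter where
  | zero
  | one
  | inf
  deriving DecidableEq

/-- The rationals of a given kind, read off from the reduced fraction `p / q`, `q > 0`:
`(0)`-rationals are even/odd, `(1)`-rationals odd/odd, `(∞)`-rationals odd/even. -/
def ratClass : Letter → Set ℚ
  | .zero => {r | Even r.num ∧ Odd r.den}
  | .one => {r | Odd r.num ∧ Odd r.den}
  | .inf => {r | Odd r.num ∧ Even r.den}

/-- The set of best `(β, γ)`-rational approximations of `x`. -/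
def bestApprox (β γ : Letter) (x : ℝ) : Set ℚ :=
  {r | r ∈ ratClass β ∪ ratClass γ ∧
    ∀ s ∈ ratClass β ∪ ratClass γ, s ≠ r → s.den ≤ r.den →
      |(r.den : ℝ) * x - (r.num : ℝ)| < |(s.den : ℝ) * x - (s.num : ℝ)|}

/-! ### The Δ-expression

`GL (Fin 2) ℝ` acts on the boundary `OnePoint ℝ` of the upper half-plane by
`x ↦ (a x + b) / (c x + d)`; matrices of determinant `-1` act by the same formula there. -/

/-- The reflections `H_0`, `H_1`, `H_∞`. -/
def H : Letter → GL (Fin 2) ℝ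
  | .zero => .mkOfDetNeZero !![-1, 2; 0, 1] (by simp [Matrix.det_fin_two])
  | .one => .mkOfDetNeZero !![-1, 0; 0, 1] (by simp [Matrix.det_fin_two])
  | .inf => .mkOfDetNeZero !![1, 0; 2, -1] (by simp [Matrix.det_fin_two])

/-- The matrix `J`, acting by `x ↦ 1 / x`. -/
def J : GL (Fin 2) ℝ := .mkOfDetNeZero !![0, 1; 1, 0] (by simp [Matrix.det_fin_two])

/-- The boundary point named by a letter. -/
def Letter.point : Letter → OnePoint ℝ
  | .zero => ((0 : ℝ) : OnePoint ℝ)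
  | .one => ((1 : ℝ) : OnePoint ℝ)
  | .inf => OnePoint.infty

/-- The permutation `σ_J` of the letters induced by `J`. -/
def sigmaJ : Letter → Letter
  | .zero => .inf
  | .one => .one
  | .inf => .zero

theorem point_sigmaJ (a : Letter) : (sigmaJ a).point = J • a.point := by
  cases a <;>
    simp [sigmaJ, Letter.point, J, OnePoint.smul_some_eq_ite, OnePoint.smul_infty_eq_ite,
      Matrix.GeneralLinearGroup.mkOfDetNeZero]

/-- The closed arcs `I_0 = [1, ∞]`, `I_1 = [-∞, 0]`, `I_∞ = [0, 1]` of the boundary. -/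
def arc : Letter → Set (OnePoint ℝ)
  | .zero => insert OnePoint.infty ((fun t : ℝ => (t : OnePoint ℝ)) '' Ici 1)
  | .one => insert OnePoint.infty ((fun t : ℝ => (t : OnePoint ℝ)) '' Iic 0)
  | .inf => (fun t : ℝ => (t : OnePoint ℝ)) '' Icc 0 1

/-- The product `H_{α 0} H_{α 1} ⋯ H_{α (n - 1)}`. -/
def prodH (α : ℕ → Letter) : ℕ → GL (Fin 2) ℝ
  | 0 => 1
  | n + 1 => prodH α n * H (α n)

/-- `x = [α 0, α 1, α 2, …]_Δ`. (The letters are indexed from `0`: `α n` is `α_{n + 1}` in the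
usual notation.) An irrational number has exactly one such expression, a rational point two. -/
def IsDeltaExpr (α : ℕ → Letter) (x : OnePoint ℝ) : Prop :=
  (∀ n, α n ≠ α (n + 1)) ∧ ∀ n, (prodH α n)⁻¹ • x ∈ arc (α n)

/-! ### The map `ψ_J` -/

/-- `m = min {j ≥ 1 | α_{j + 1} = 0}`, where `α_{j + 1}` is `α j` in the present indexing. -/
def IsFirstZero (α : ℕ → Letter) (m : ℕ) : Prop :=
  IsLeast {j | 1 ≤ j ∧ α j = Letter.zero} m

/-- The sequence `σ_J(0) = σ_J(α_{m + 1}), σ_J(α_{m + 2}), …`. -/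
def shiftJ (α : ℕ → Letter) (m : ℕ) : ℕ → Letter := fun n => sigmaJ (α (m + n))

/-- The graph of `ψ_J`: `x = [∞, α_2, α_3, …]_Δ` and `y = [σ_J(0), σ_J(α_{m + 2}), …]_Δ`. -/
def PsiJGraph (x y : ℝ) : Prop :=
  ∃ α : ℕ → Letter, ∃ m : ℕ, IsDeltaExpr α (x : OnePoint ℝ) ∧ α 0 = Letter.inf ∧
    IsFirstZero α m ∧ IsDeltaExpr (shiftJ α m) (y : OnePoint ℝ)

open Classical in
/-- The map `ψ_J` on `[0, 1]`. The point `0 = [∞, 1, ∞, 1, …]_Δ` has no letter `0`; it is sent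
to `0`. -/
def psiJ (x : ℝ) : ℝ := if h : ∃ y, PsiJGraph x y then h.choose else 0

/-! ### The even continued fraction -/

/-- The even continued fraction map: the distance from `1 / x` to the nearest even integer
(and `0 ↦ 0`). -/
def evenMap (x : ℝ) : ℝ := Metric.infDist (1 / x) (range fun k : ℤ => 2 * (k : ℝ))

/-- The even integer nearest to `1 / t`. -/
def evenDigit (t : ℝ) : ℤ := 2 * round (1 / t / 2)

/-- The sign `ε` with `1 / t = evenDigit t + ε * evenMap t`. -/
def evenSign (t : ℝ) : ℝ := if (evenDigit t : ℝ) ≤ 1 / t then 1 else -1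

/-- One step of the even continued fraction algorithm: from the remainder `t ≠ 0`, entering with
sign `ε`, output partial numerator `ε` and partial denominator `evenDigit t`, and pass to the
remainder `evenMap t`. -/
def evenStep (s : ℝ × ℝ) : Option (GenContFract.Pair ℝ × (ℝ × ℝ)) :=
  if s.2 = 0 then none
  else some (⟨s.1, evenDigit s.2⟩, (evenSign s.2, evenMap s.2))

/-- The even continued fraction expansion
`0 + 1 / (b₁ + ε₁ / (b₂ + ε₂ / (b₃ + ⋯)))` of `x ∈ [0, 1]`. -/
def evenContFract (x : ℝ) : GenContFract ℝ := ⟨0, Stream'.Seq.corec evenStep (1, x)⟩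

/-- The `n`-th convergent of the even continued fraction of `x`, that is, the truncation
`0 + 1 / (b₁ + ε₁ / (b₂ + ⋯ + εₙ₋₁ / bₙ))`; for `n = 0` it is `0`. -/
def evenConvergent (x : ℝ) (n : ℕ) : ℝ := (evenContFract x).convs' n

/-! ### Inverse branches -/

/-- `S` is a closed subinterval of `[0, 1]` containing `x` on which `f` is continuous and
invertible. -/
def IsBranch (f : ℝ → ℝ) (x : ℝ) (S : Set ℝ) : Prop :=
  (∃ u v : ℝ, S = Icc u v) ∧ S ⊆ Icc 0 1 ∧ x ∈ S ∧ ContinuousOn f S ∧ InjOn f S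

/-- The largest interval as in `IsBranch` (the union of all of them). -/
def branchInterval (f : ℝ → ℝ) (x : ℝ) : Set ℝ := ⋃₀ {S | IsBranch f x S}

/-- The map `(ψ_J)_x^{-i}`: the inverse of the `i`-th iterate of `ψ_J` on its branch interval
containing `x`. -/
def psiJInv (x : ℝ) (i : ℕ) : ℝ → ℝ :=
  Function.invFunOn psiJ^[i] (branchInterval psiJ^[i] x)

end DeltaCF

end

noncomputable section

namespace DeltaCF

/-! ### The action of the reflections -/

/-! Conjugation by `J` exchanges `H .zero` with `H .inf` and fixes the action of `H .one`, so
`shiftJ α m` describes the image under `J` of a tail of the point. For a point `x` of (0, 1] the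
tails are explicit: `J` sends `H_∞ x` to `2 - 1/x` and `H_1 H_∞ x` to `1/x - 2`. If letter 0 comes
next in either case, this is already the distance from `1/x` to 2. Otherwise the letters begin ∞, 1,
∞, and removing the block ∞, 1 lowers `1/x` by 2, which does not change the even map; induction on a
bound for `1/x` finishes (`exists_isFirstZero_aux`). An expression determines its point because, in
suitable charts, the reflections are branches of the Farey map and stretch a distance `d` to at
least `d (1 + d)` (`IsDeltaExpr.eq`).

The branch of an iterate at an irrational `x` is the image of [0, 1] under the explicit inverse
`evenInv`. It is maximal because the iterate takes the values 0 and 1 at its ends, so no monotone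
extension can stay within [0, 1] (`IsBranch.subset_of_bijOn`).

Consecutive convergents form a basis of ℤ² consisting of vectors with odd coordinate sum. A
competitor `u (p, q) + v (p', q')` of the same parity has `u + v` odd, and a denominator in (0, q')
forces `|u| > |v|` unless the competitor is `p/q`. As the errors decrease, the triangle inequality
makes `p/q` win (`abs_error_lt_of_unimodular`). -/

theorem H_zero_coe (x : ℝ) : H .zero • (x : OnePoint ℝ) = ((2 - x : ℝ) : OnePoint ℝ) := by
  simp [H, OnePoint.smul_some_eq_ite, Matrix.GeneralLinearGroup.mkOfDetNeZero]
  ring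

theorem H_zero_infty : H .zero • (OnePoint.infty : OnePoint ℝ) = OnePoint.infty := by
  simp [H, OnePoint.smul_infty_eq_ite, Matrix.GeneralLinearGroup.mkOfDetNeZero]

theorem H_one_coe (x : ℝ) : H .one • (x : OnePoint ℝ) = ((-x : ℝ) : OnePoint ℝ) := by
  simp [H, OnePoint.smul_some_eq_ite, Matrix.GeneralLinearGroup.mkOfDetNeZero]

theorem H_one_infty : H .one • (OnePoint.infty : OnePoint ℝ) = OnePoint.infty := by
  simp [H, OnePoint.smul_infty_eq_ite, Matrix.GeneralLinearGroup.mkOfDetNeZero]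

theorem H_inf_coe (x : ℝ) : H .inf • (x : OnePoint ℝ) =
    if 2 * x - 1 = 0 then OnePoint.infty else ((x / (2 * x - 1) : ℝ) : OnePoint ℝ) := by
  simp [H, OnePoint.smul_some_eq_ite, Matrix.GeneralLinearGroup.mkOfDetNeZero, sub_eq_add_neg]

theorem J_coe (x : ℝ) : J • (x : OnePoint ℝ) =
    if x = 0 then OnePoint.infty else ((1 / x : ℝ) : OnePoint ℝ) := by
  simp [J, OnePoint.smul_some_eq_ite, Matrix.GeneralLinearGroup.mkOfDetNeZero]

theorem J_infty : J • (OnePoint.infty : OnePoint ℝ) = ((0 : ℝ) : OnePoint ℝ) := by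
  simp [J, OnePoint.smul_infty_eq_ite, Matrix.GeneralLinearGroup.mkOfDetNeZero]

theorem H_mul_self (a : Letter) : H a * H a = 1 := by
  ext i j
  cases a <;> fin_cases i <;> fin_cases j <;>
    simp [H, Matrix.GeneralLinearGroup.mkOfDetNeZero, Matrix.mul_apply, Fin.sum_univ_two]

theorem H_inv (a : Letter) : (H a)⁻¹ = H a :=
  inv_eq_of_mul_eq_one_left (H_mul_self a)

theorem J_smul_H_smul (a : Letter) (x : OnePoint ℝ) :
    J • H a • x = H (sigmaJ a) • J • x := by
  cases a
  · rw [← mul_smul, ← mul_smul]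
    congr 1
    ext i j
    fin_cases i <;> fin_cases j <;>
      simp [H, J, sigmaJ, Matrix.GeneralLinearGroup.mkOfDetNeZero, Matrix.mul_apply,
        Fin.sum_univ_two]
  -- For the letter 1 the two matrix products differ by the factor -1: they agree only as Möbius
  -- maps, so the identity is checked on points.
  · rw [sigmaJ]
    induction x using OnePoint.rec with
    | infty => rw [H_one_infty, J_infty, H_one_coe, neg_zero]
    | coe x =>
      rw [H_one_coe, J_coe, J_coe]
      by_cases h : x = 0
      · simp [h, H_one_infty]
      · rw [if_neg h, if_neg (neg_ne_zero.2 h), H_one_coe, div_neg]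
  · rw [← mul_smul, ← mul_smul]
    congr 1
    ext i j
    fin_cases i <;> fin_cases j <;>
      simp [H, J, sigmaJ, Matrix.GeneralLinearGroup.mkOfDetNeZero, Matrix.mul_apply,
        Fin.sum_univ_two]

@[simp]
theorem coe_mem_arc_zero {x : ℝ} : (x : OnePoint ℝ) ∈ arc .zero ↔ 1 ≤ x := by
  simp [arc]

@[simp]
theorem coe_mem_arc_one {x : ℝ} : (x : OnePoint ℝ) ∈ arc .one ↔ x ≤ 0 := by
  simp [arc]

@[simp]
theorem coe_mem_arc_inf {x : ℝ} : (x : OnePoint ℝ) ∈ arc .inf ↔ 0 ≤ x ∧ x ≤ 1 := by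
  simp [arc]

@[simp]
theorem infty_mem_arc_zero : OnePoint.infty ∈ arc .zero := by
  simp [arc]

@[simp]
theorem infty_mem_arc_one : OnePoint.infty ∈ arc .one := by
  simp [arc]

@[simp]
theorem infty_notMem_arc_inf : OnePoint.infty ∉ arc .inf := by
  simp [arc]

theorem J_smul_mem_arc {a : Letter} {x : OnePoint ℝ} (hx : x ∈ arc a) :
    J • x ∈ arc (sigmaJ a) := by
  induction x using OnePoint.rec with
  | infty =>
    rw [J_infty]
    cases a <;> simp_all [sigmaJ]
  | coe x =>
    rw [J_coe]
    cases a
    · rw [coe_mem_arc_zero] at hx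
      rw [if_neg (by positivity), sigmaJ, coe_mem_arc_inf]
      exact ⟨by positivity, by rw [div_le_one (by positivity)]; exact hx⟩
    · rw [coe_mem_arc_one] at hx
      split_ifs
      · simp [sigmaJ]
      · rw [sigmaJ, coe_mem_arc_one]
        exact one_div_nonpos.2 hx
    · rw [coe_mem_arc_inf] at hx
      split_ifs with h
      · simp [sigmaJ]
      · rw [sigmaJ, coe_mem_arc_zero, le_div_iff₀ (lt_of_le_of_ne hx.1 (Ne.symm h)), one_mul]
        exact hx.2

/-! ### Shifting and conjugating Δ-expressions -/

theorem prodH_succ_left (α : ℕ → Letter) (n : ℕ) :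
    prodH α (n + 1) = H (α 0) * prodH (fun k => α (k + 1)) n := by
  induction n with
  | zero => simp [prodH]
  | succ n ih => rw [prodH, ih, prodH, mul_assoc]

/-- The reflections are involutions, so dropping the first letter amounts to applying that letter's
reflection to the point. -/
theorem isDeltaExpr_iff_tail {α : ℕ → Letter} {x : OnePoint ℝ} :
    IsDeltaExpr α x ↔ α 0 ≠ α 1 ∧ x ∈ arc (α 0) ∧
      IsDeltaExpr (fun k => α (k + 1)) (H (α 0) • x) := by
  have key (n : ℕ) : (prodH α (n + 1))⁻¹ • x =
      (prodH (fun k => α (k + 1)) n)⁻¹ • H (α 0) • x := by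
    rw [prodH_succ_left, mul_inv_rev, H_inv, mul_smul]
  constructor
  · rintro ⟨h₁, h₂⟩
    refine ⟨h₁ 0, by simpa [prodH] using h₂ 0, fun n => h₁ (n + 1), fun n => ?_⟩
    rw [← key]
    exact h₂ (n + 1)
  · rintro ⟨h, hx, h₁, h₂⟩
    refine ⟨fun n => ?_, fun n => ?_⟩
    · cases n with
      | zero => exact h
      | succ n => exact h₁ n
    · cases n with
      | zero => simpa [prodH] using hx
      | succ n => rw [key]; exact h₂ n

theorem sigmaJ_injective : Function.Injective sigmaJ := by
  intro a b h
  cases a <;> cases b <;> simp_all [sigmaJ]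

theorem prodH_succ_inv_smul (α : ℕ → Letter) (n : ℕ) (x : OnePoint ℝ) :
    (prodH α (n + 1))⁻¹ • x = H (α n) • (prodH α n)⁻¹ • x := by
  rw [prodH, mul_inv_rev, H_inv, mul_smul]

theorem IsDeltaExpr.conj {α : ℕ → Letter} {x : OnePoint ℝ} (h : IsDeltaExpr α x) :
    IsDeltaExpr (fun k => sigmaJ (α k)) (J • x) := by
  have key (n : ℕ) : (prodH (fun k => sigmaJ (α k)) n)⁻¹ • J • x = J • (prodH α n)⁻¹ • x := by
    induction n with
    | zero => simp [prodH]
    | succ n ih => rw [prodH_succ_inv_smul, prodH_succ_inv_smul, ih, J_smul_H_smul]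
  refine ⟨fun n hn => h.1 n (sigmaJ_injective hn), fun n => ?_⟩
  rw [key]
  exact J_smul_mem_arc (h.2 n)

/-! ### Existence of Δ-expressions -/

/-- The reflection `H a` carries `arc a` into the union of the other two arcs; where these meet,
either letter may follow. -/
theorem exists_next_letter (a : Letter) (x : OnePoint ℝ) (hx : x ∈ arc a) :
    ∃ b, a ≠ b ∧ H a • x ∈ arc b := by
  induction x using OnePoint.rec with
  | infty =>
    cases a
    · exact ⟨.one, by simp, by simp [H_zero_infty]⟩
    · exact ⟨.zero, by simp, by simp [H_one_infty]⟩
    · simp at hx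
  | coe x =>
    cases a
    · rw [coe_mem_arc_zero] at hx
      rw [H_zero_coe]
      rcases le_total x 2 with h | h
      · exact ⟨.inf, by simp, coe_mem_arc_inf.2 ⟨by linarith, by linarith⟩⟩
      · exact ⟨.one, by simp, coe_mem_arc_one.2 (by linarith)⟩
    · rw [coe_mem_arc_one] at hx
      rw [H_one_coe]
      rcases le_total (-x) 1 with h | h
      · exact ⟨.inf, by simp, coe_mem_arc_inf.2 ⟨by linarith, h⟩⟩
      · exact ⟨.zero, by simp, coe_mem_arc_zero.2 h⟩
    · rw [coe_mem_arc_inf] at hx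
      rw [H_inf_coe]
      split_ifs with h
      · exact ⟨.zero, by simp, by simp⟩
      · rcases lt_or_gt_of_ne h with h | h
        · exact ⟨.one, by simp, coe_mem_arc_one.2 (div_nonpos_of_nonneg_of_nonpos hx.1 h.le)⟩
        · refine ⟨.zero, by simp, coe_mem_arc_zero.2 ?_⟩
          rw [le_div_iff₀ h]
          linarith

theorem exists_isDeltaExpr {a : Letter} {x : OnePoint ℝ} (hx : x ∈ arc a) :
    ∃ α : ℕ → Letter, IsDeltaExpr α x ∧ α 0 = a := by
  choose! next hne hmem using exists_next_letter
  let s : ℕ → Letter × OnePoint ℝ := fun n =>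
    (fun p : Letter × OnePoint ℝ => (next p.1 p.2, H p.1 • p.2))^[n] (a, x)
  have hs (n : ℕ) : s (n + 1) = (next (s n).1 (s n).2, H (s n).1 • (s n).2) :=
    Function.iterate_succ_apply' _ _ _
  have hs_mem (n : ℕ) : (s n).2 ∈ arc (s n).1 := by
    induction n with
    | zero => exact hx
    | succ n ih => rw [hs]; exact hmem _ _ ih
  have hs_prod (n : ℕ) : (prodH (fun k => (s k).1) n)⁻¹ • x = (s n).2 := by
    induction n with
    | zero => simp [prodH, s]
    | succ n ih => rw [prodH_succ_inv_smul, ih, hs]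
  refine ⟨fun n => (s n).1, ⟨fun n => ?_, fun n => ?_⟩, rfl⟩
  · simp only [hs]
    exact hne _ _ (hs_mem n)
  · rw [hs_prod]
    exact hs_mem n

/-! ### Uniqueness of the point with a given Δ-expression -/

/-- A projective coordinate that identifies the arc `arc a` with `[0, 1]`. -/
def chart : Letter → OnePoint ℝ → ℝ
  | .zero, x => x.elim 0 fun t => 1 / t
  | .one, x => x.elim 1 fun t => t / (t - 1)
  | .inf, x => x.elim 0 id

theorem chart_mem {a : Letter} {x : OnePoint ℝ} (hx : x ∈ arc a) : chart a x ∈ Icc (0 : ℝ) 1 := by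
  induction x using OnePoint.rec with
  | infty => cases a <;> simp [chart]
  | coe x =>
    cases a
    · rw [coe_mem_arc_zero] at hx
      exact ⟨show (0 : ℝ) ≤ 1 / x by positivity, show 1 / x ≤ 1 from
        (div_le_one (by positivity)).2 hx⟩
    · rw [coe_mem_arc_one] at hx
      exact ⟨show 0 ≤ x / (x - 1) from div_nonneg_of_nonpos hx (by linarith),
        show x / (x - 1) ≤ 1 by rw [div_le_one_of_neg (by linarith)]; linarith⟩
    · exact coe_mem_arc_inf.1 hx

theorem chart_injOn (a : Letter) : InjOn (chart a) (arc a) := by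
  intro x hx y hy h
  induction x using OnePoint.rec with
  | infty =>
    induction y using OnePoint.rec with
    | infty => rfl
    | coe y =>
      cases a
      · rw [coe_mem_arc_zero] at hy
        have : (0 : ℝ) = 1 / y := h
        have : 0 < 1 / y := by positivity
        linarith
      · rw [coe_mem_arc_one] at hy
        have h : (1 : ℝ) = y / (y - 1) := h
        rw [eq_div_iff (by linarith)] at h
        linarith
      · simp at hx
  | coe x =>
    induction y using OnePoint.rec with
    | infty =>
      cases a
      · rw [coe_mem_arc_zero] at hx
        have : 1 / x = 0 := h
        have : 0 < 1 / x := by positivity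
        linarith
      · rw [coe_mem_arc_one] at hx
        have h : x / (x - 1) = 1 := h
        rw [div_eq_iff (by linarith)] at h
        linarith
      · simp at hy
    | coe y =>
      congr 1
      cases a
      · have h : 1 / x = 1 / y := h
        simpa using h
      · rw [coe_mem_arc_one] at hx hy
        have h : x / (x - 1) = y / (y - 1) := h
        rw [div_eq_div_iff (by linarith) (by linarith)] at h
        linarith
      · exact h

/-- The action of a reflection in the charts of two consecutive letters: one of the two branches
`u ↦ u / (1 - u)`, `u ↦ 2 - 1 / u` of the Farey map, possibly followed by `u ↦ 1 - u`. -/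
theorem chart_smul (a b : Letter) (hab : a ≠ b) :
    (∀ x ∈ arc a, H a • x ∈ arc b → chart a x ≤ 1 / 2 ∧
      chart b (H a • x) = chart a x / (1 - chart a x)) ∨
    (∀ x ∈ arc a, H a • x ∈ arc b → chart a x ≤ 1 / 2 ∧
      chart b (H a • x) = 1 - chart a x / (1 - chart a x)) ∨
    (∀ x ∈ arc a, H a • x ∈ arc b → 1 / 2 ≤ chart a x ∧
      chart b (H a • x) = 2 - 1 / chart a x) ∨
    (∀ x ∈ arc a, H a • x ∈ arc b → 1 / 2 ≤ chart a x ∧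
      chart b (H a • x) = 1 / chart a x - 1) := by
  cases a <;> cases b <;> try exact absurd rfl hab
  · refine Or.inr (Or.inl fun x hx hy => ?_)
    induction x using OnePoint.rec with
    | infty => simp [H_zero_infty, chart]
    | coe x =>
      rw [H_zero_coe] at hy ⊢
      rw [coe_mem_arc_zero] at hx
      rw [coe_mem_arc_one] at hy
      change 1 / x ≤ 1 / 2 ∧ (2 - x) / (2 - x - 1) = 1 - 1 / x / (1 - 1 / x)
      have h₁ : x ≠ 0 := by linarith
      have h₂ : x - 1 ≠ 0 := by intro h; linarith
      have h₃ : 2 - x - 1 ≠ 0 := by intro h; linarith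
      have h₄ : 1 - 1 / x = (x - 1) / x := by field_simp
      refine ⟨one_div_le_one_div_of_le (by norm_num) (by linarith), ?_⟩
      rw [h₄]
      field_simp
      ring
  · refine Or.inr (Or.inr (Or.inl fun x hx hy => ?_))
    induction x using OnePoint.rec with
    | infty => simp [H_zero_infty] at hy
    | coe x =>
      rw [H_zero_coe] at hy ⊢
      rw [coe_mem_arc_zero] at hx
      rw [coe_mem_arc_inf] at hy
      change 1 / 2 ≤ 1 / x ∧ 2 - x = 2 - 1 / (1 / x)
      exact ⟨one_div_le_one_div_of_le (by linarith) (by linarith), by simp⟩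
  · refine Or.inr (Or.inr (Or.inr fun x hx hy => ?_))
    induction x using OnePoint.rec with
    | infty => norm_num [H_one_infty, chart]
    | coe x =>
      rw [H_one_coe] at hy ⊢
      rw [coe_mem_arc_one] at hx
      rw [coe_mem_arc_zero] at hy
      change 1 / 2 ≤ x / (x - 1) ∧ 1 / (-x) = 1 / (x / (x - 1)) - 1
      refine ⟨?_, ?_⟩
      · rw [le_div_iff_of_neg (by linarith)]
        linarith
      · have h₁ : x ≠ 0 := by intro h; linarith
        have h₂ : x - 1 ≠ 0 := by intro h; linarith
        field_simp
        ring
  · refine Or.inl fun x hx hy => ?_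
    induction x using OnePoint.rec with
    | infty => simp [H_one_infty] at hy
    | coe x =>
      rw [H_one_coe] at hy ⊢
      rw [coe_mem_arc_one] at hx
      rw [coe_mem_arc_inf] at hy
      change x / (x - 1) ≤ 1 / 2 ∧ -x = x / (x - 1) / (1 - x / (x - 1))
      have h₂ : x - 1 ≠ 0 := by intro h; linarith
      refine ⟨?_, ?_⟩
      · rw [div_le_iff_of_neg (by linarith)]
        linarith
      · have : 1 - x / (x - 1) = -1 / (x - 1) := by
          field_simp
          ring
        rw [this]
        field_simp
  · refine Or.inr (Or.inr (Or.inl fun x hx hy => ?_))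
    induction x using OnePoint.rec with
    | infty => simp at hx
    | coe x =>
      rw [H_inf_coe] at hy ⊢
      rw [coe_mem_arc_inf] at hx
      split_ifs at hy ⊢ with h
      · have hx' : x = 1 / 2 := by linarith
        subst hx'
        norm_num [chart]
      · rw [coe_mem_arc_zero] at hy
        change 1 / 2 ≤ x ∧ 1 / (x / (2 * x - 1)) = 2 - 1 / x
        have h₁ : 0 < 2 * x - 1 := by
          by_contra h'
          have := div_nonpos_of_nonneg_of_nonpos hx.1 (not_lt.1 h')
          linarith
        have h₂ : x ≠ 0 := by intro h; linarith
        exact ⟨by linarith, by field_simp⟩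
  · refine Or.inl fun x hx hy => ?_
    induction x using OnePoint.rec with
    | infty => simp at hx
    | coe x =>
      rw [H_inf_coe] at hy ⊢
      rw [coe_mem_arc_inf] at hx
      split_ifs at hy ⊢ with h
      · have hx' : x = 1 / 2 := by linarith
        subst hx'
        norm_num [chart]
      · rw [coe_mem_arc_one] at hy
        change x ≤ 1 / 2 ∧ x / (2 * x - 1) / (x / (2 * x - 1) - 1) = x / (1 - x)
        have h₁ : 2 * x - 1 < 0 := by
          by_contra h'
          have h' : 0 < 2 * x - 1 := lt_of_le_of_ne (not_lt.1 h') (Ne.symm h)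
          have : 0 < x / (2 * x - 1) := div_pos (by linarith) h'
          linarith
        refine ⟨by linarith, ?_⟩
        have h₂ : x / (2 * x - 1) - 1 = (1 - x) / (2 * x - 1) := by
          rw [eq_div_iff h, sub_mul, div_mul_cancel₀ _ h]
          ring
        rw [h₂, div_div_div_cancel_right₀ h]

/-- The difference of the images is `(u - v) / ((1 - u) (1 - v))`, and `(1 - u) (1 - v) (1 + |u -
v|) ≤ 1`. The branch has slope 1 at its fixed point 0, so no uniform factor above 1 is possible; `1
+ |u - v|` replaces it. -/
theorem farey_left_expands {u v : ℝ} (hu : 0 ≤ u) (hv : 0 ≤ v) (hu' : u ≤ 1 / 2)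
    (hv' : v ≤ 1 / 2) :
    |u - v| * (1 + |u - v|) ≤ |u / (1 - u) - v / (1 - v)| := by
  have h₁ : 0 < 1 - u := by linarith
  have h₂ : 0 < 1 - v := by linarith
  have h : u / (1 - u) - v / (1 - v) = (u - v) / ((1 - u) * (1 - v)) := by
    field_simp
    ring
  rw [h, abs_div, abs_of_pos (mul_pos h₁ h₂), le_div_iff₀ (mul_pos h₁ h₂), mul_assoc]
  refine mul_le_of_le_one_right (abs_nonneg _) ?_
  rcases abs_cases (u - v) with ⟨h, _⟩ | ⟨h, _⟩ <;> rw [h]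
  · nlinarith [mul_nonneg hu hv, mul_nonneg hv h₁.le, mul_nonneg hu h₁.le,
      mul_nonneg hv (mul_nonneg h₁.le h₂.le), mul_nonneg hu (mul_nonneg h₁.le h₂.le)]
  · nlinarith [mul_nonneg hu hv, mul_nonneg hu h₂.le, mul_nonneg hv h₂.le,
      mul_nonneg hv (mul_nonneg h₁.le h₂.le), mul_nonneg hu (mul_nonneg h₁.le h₂.le)]

/-- This is the left branch after the substitution `u ↦ 1 - u`. -/
theorem farey_right_expands {u v : ℝ} (hu : u ≤ 1) (hv : v ≤ 1) (hu' : 1 / 2 ≤ u)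
    (hv' : 1 / 2 ≤ v) :
    |u - v| * (1 + |u - v|) ≤ |1 / u - 1 / v| := by
  have h := farey_left_expands (u := 1 - u) (v := 1 - v) (by linarith) (by linarith)
    (by linarith) (by linarith)
  have h₁ : u ≠ 0 := by linarith
  have h₂ : v ≠ 0 := by linarith
  have e : (1 - u) / (1 - (1 - u)) - (1 - v) / (1 - (1 - v)) = 1 / u - 1 / v := by
    rw [sub_sub_cancel, sub_sub_cancel]
    field_simp
    ring
  rwa [e, sub_sub_sub_cancel_left, abs_sub_comm v u] at h

theorem dist_chart_expands {a b : Letter} (hab : a ≠ b) {x y : OnePoint ℝ} (hx : x ∈ arc a)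
    (hy : y ∈ arc a) (hx' : H a • x ∈ arc b) (hy' : H a • y ∈ arc b) :
    |chart a x - chart a y| * (1 + |chart a x - chart a y|) ≤
      |chart b (H a • x) - chart b (H a • y)| := by
  have hcx := chart_mem hx
  have hcy := chart_mem hy
  rcases chart_smul a b hab with h | h | h | h <;>
    obtain ⟨h₁, e₁⟩ := h x hx hx' <;> obtain ⟨h₂, e₂⟩ := h y hy hy' <;> rw [e₁, e₂]
  · exact farey_left_expands hcx.1 hcy.1 h₁ h₂
  · rw [sub_sub_sub_cancel_left, abs_sub_comm (_ / _)]
    exact farey_left_expands hcx.1 hcy.1 h₁ h₂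
  · rw [sub_sub_sub_cancel_left, abs_sub_comm (_ / _)]
    exact farey_right_expands hcx.2 hcy.2 h₁ h₂
  · rw [sub_sub_sub_cancel_right]
    exact farey_right_expands hcx.2 hcy.2 h₁ h₂

/-- Let `d n` be the chart distance of the `n`-th tails. It never exceeds 1, yet `d n * (1 + d n) ≤
d (n + 1)` makes it grow at least linearly unless `d 0 = 0`. -/
theorem IsDeltaExpr.eq {α : ℕ → Letter} {x y : OnePoint ℝ} (hx : IsDeltaExpr α x)
    (hy : IsDeltaExpr α y) : x = y := by
  let d : ℕ → ℝ := fun n =>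
    |chart (α n) ((prodH α n)⁻¹ • x) - chart (α n) ((prodH α n)⁻¹ • y)|
  have step (n : ℕ) : d n * (1 + d n) ≤ d (n + 1) := by
    have h₁ := hx.2 (n + 1)
    have h₂ := hy.2 (n + 1)
    simp only [d]
    rw [prodH_succ_inv_smul] at h₁ h₂ ⊢
    rw [prodH_succ_inv_smul]
    exact dist_chart_expands (hx.1 n) (hx.2 n) (hy.2 n) h₁ h₂
  have hd (n : ℕ) : 0 ≤ d n := abs_nonneg _
  have grow (n : ℕ) : d 0 * (1 + n * d 0) ≤ d n ∧ d 0 ≤ d n := by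
    induction n with
    | zero => simp
    | succ n ih =>
      have h₁ := step n
      have h₂ : d 0 * d 0 ≤ d n * d n := mul_self_le_mul_self (hd 0) ih.2
      push_cast
      exact ⟨by nlinarith [ih.1], by nlinarith [ih.2, mul_self_nonneg (d n)]⟩
  have hle (n : ℕ) : d n ≤ 1 := by
    have h₁ := chart_mem (hx.2 n)
    have h₂ := chart_mem (hy.2 n)
    exact abs_sub_le_iff.2 ⟨by linarith [h₁.2, h₂.1], by linarith [h₂.2, h₁.1]⟩
  have h0 : d 0 = 0 := by
    by_contra h
    have hpos : 0 < d 0 * d 0 := mul_self_pos.2 h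
    obtain ⟨n, hn⟩ := exists_nat_gt (1 / (d 0 * d 0))
    rw [div_lt_iff₀ hpos] at hn
    nlinarith [(grow n).1, hle n, hd 0]
  have hx0 := hx.2 0
  have hy0 := hy.2 0
  have := chart_injOn (α 0) hx0 hy0 (sub_eq_zero.1 (abs_eq_zero.1 h0))
  simpa [prodH] using this

/-! ### The even continued fraction map -/

theorem infDist_even (k : ℤ) {z : ℝ} (hz : |z| ≤ 1) :
    Metric.infDist (2 * (k : ℝ) + z) (range fun k : ℤ => 2 * (k : ℝ)) = |z| := by
  refine le_antisymm ?_ ?_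
  · refine (Metric.infDist_le_dist_of_mem (mem_range_self k)).trans_eq ?_
    rw [Real.dist_eq, add_sub_cancel_left]
  · refine (Metric.le_infDist (range_nonempty _)).2 ?_
    rintro _ ⟨l, rfl⟩
    rw [Real.dist_eq]
    rcases lt_trichotomy k l with h | rfl | h
    · have h' : (k : ℝ) + 1 ≤ l := by exact_mod_cast h
      rw [abs_of_nonpos (a := _ - _) (by linarith [(abs_le.1 hz).2])]
      linarith [(abs_le.1 hz).2]
    · rw [add_sub_cancel_left]
    · have h' : (l : ℝ) + 1 ≤ k := by exact_mod_cast h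
      rw [abs_of_nonneg (a := _ - _) (by linarith [(abs_le.1 hz).1])]
      linarith [(abs_le.1 hz).1]

/-- Ties `|z| = 1` are allowed: when `1 / t` is odd, either neighbouring even integer computes the
map. -/
theorem evenMap_of_one_div_eq {t z : ℝ} (k : ℤ) (h : 1 / t = 2 * (k : ℝ) + z) (hz : |z| ≤ 1) :
    evenMap t = |z| := by
  rw [evenMap, h, infDist_even k hz]

theorem abs_one_div_sub_evenDigit_le (t : ℝ) : |1 / t - evenDigit t| ≤ 1 := by
  have h := abs_sub_round (1 / t / 2)
  rw [abs_le] at h ⊢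
  rw [evenDigit]
  push_cast
  constructor <;> linarith [h.1, h.2]

theorem evenMap_eq_abs (t : ℝ) : evenMap t = |1 / t - evenDigit t| :=
  evenMap_of_one_div_eq (round (1 / t / 2)) (by rw [evenDigit]; push_cast; ring)
    (abs_one_div_sub_evenDigit_le t)

theorem evenMap_mem (t : ℝ) : evenMap t ∈ Icc (0 : ℝ) 1 := by
  rw [evenMap_eq_abs]
  exact ⟨abs_nonneg _, abs_one_div_sub_evenDigit_le t⟩

theorem evenMap_zero : evenMap 0 = 0 := by
  simpa using evenMap_of_one_div_eq (t := 0) (z := 0) 0 (by simp) (by simp)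

theorem evenMap_congr {s t : ℝ} (h : 1 / s + 2 = 1 / t) : evenMap s = evenMap t := by
  rw [evenMap_eq_abs s]
  refine (evenMap_of_one_div_eq (round (1 / s / 2) + 1) ?_ (abs_one_div_sub_evenDigit_le s)).symm
  rw [← h, evenDigit]
  push_cast
  ring

/-! ### The map `ψ_J` is the even continued fraction map -/

/-- The bound `N` on `1 / x` drives the induction: a block ∞, 1 followed by ∞ lowers `1 / x` by 2
and leaves `evenMap x` unchanged. The expression is arbitrary, which is what makes the value
independent of its choice. -/
theorem exists_isFirstZero_aux (N : ℕ) : ∀ x ∈ Ioc (0 : ℝ) 1, 1 / x ≤ N →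
    ∀ α : ℕ → Letter, IsDeltaExpr α (x : OnePoint ℝ) → α 0 = .inf →
      ∃ m, IsFirstZero α m ∧ IsDeltaExpr (shiftJ α m) ((evenMap x : ℝ) : OnePoint ℝ) := by
  induction N with
  | zero =>
    intro x hx hN
    have : 0 < 1 / x := one_div_pos.2 hx.1
    rw [Nat.cast_zero] at hN
    linarith
  | succ N ih =>
    intro x hx hN α hα h0
    obtain ⟨h01, -, hα₁⟩ := isDeltaExpr_iff_tail.1 hα
    obtain ⟨h12, hm₁, hα₂⟩ := isDeltaExpr_iff_tail.1 hα₁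
    have hx0 : x ≠ 0 := hx.1.ne'
    have hinv : x * (1 / x) = 1 := by field_simp
    have hx1 : 1 ≤ 1 / x := by rw [le_div_iff₀ hx.1]; linarith [hx.2]
    simp only [zero_add, h0] at hm₁ hα₁ h01
    simp only [zero_add, h0, Nat.reduceAdd] at hα₂ h12
    rw [H_inf_coe] at hm₁ hα₁ hα₂
    have hsplit : α 1 = .zero ∨ α 1 = .one := by
      cases h : α 1 <;> simp_all
    rcases hsplit with h1 | h1
    -- Here `1 / x` lies in [1, 2], and `J` sends `H_∞ x` to `2 - 1 / x`. At `x = 1 / 2` the point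
    -- `H_∞ x` is infinite and `J` sends it to 0.
    · have hfirst : IsFirstZero α 1 := ⟨⟨le_rfl, h1⟩, fun j hj => hj.1⟩
      refine ⟨1, hfirst, ?_⟩
      have hconj := hα₁.conj
      have hval : J • (if 2 * x - 1 = 0 then (OnePoint.infty : OnePoint ℝ)
          else ((x / (2 * x - 1) : ℝ) : OnePoint ℝ)) = ((evenMap x : ℝ) : OnePoint ℝ) := by
        rw [h1] at hm₁
        split_ifs at hm₁ ⊢ with h
        · rw [J_infty]
          have : 1 / x = 2 * ((1 : ℤ) : ℝ) + 0 := by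
            rw [div_eq_iff hx0]; push_cast; linarith
          rw [evenMap_of_one_div_eq 1 this (by simp), abs_zero]
        · rw [coe_mem_arc_zero] at hm₁
          have h₁ : 0 < 2 * x - 1 := by
            by_contra h'
            have := div_nonpos_of_nonneg_of_nonpos hx.1.le (not_lt.1 h')
            linarith
          rw [J_coe, if_neg (div_ne_zero hx0 h)]
          have e : 1 / (x / (2 * x - 1)) = 2 - 1 / x := by field_simp
          have : 1 / x = 2 * ((1 : ℤ) : ℝ) + -(2 - 1 / x) := by push_cast; ring
          have h₂ : 1 / x ≤ 2 := by rw [div_le_iff₀ hx.1]; linarith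
          rw [e, evenMap_of_one_div_eq 1 this (by rw [abs_le]; constructor <;> linarith), abs_neg,
            abs_of_nonneg (by linarith)]
      rw [hval] at hconj
      have hshift : shiftJ α 1 = fun k => sigmaJ (α (k + 1)) := by
        funext k
        rw [shiftJ, add_comm]
      rwa [hshift]
    -- Here `1 / x ≥ 2`, and two reflections take `x` to `x / (1 - 2 * x)`, whose reciprocal is `1 /
    -- x - 2` (the point ∞ if `x = 1 / 2`).
    · rw [h1] at hm₁ hα₂ h12
      have hle : 2 * x - 1 ≤ 0 := by
        by_contra h'
        rw [if_neg (by linarith), coe_mem_arc_one] at hm₁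
        have := div_pos hx.1 (not_le.1 h')
        linarith
      have h2x : 2 ≤ 1 / x := by rw [le_div_iff₀ hx.1]; linarith
      have hx₂ : H .one • (if 2 * x - 1 = 0 then (OnePoint.infty : OnePoint ℝ)
          else ((x / (2 * x - 1) : ℝ) : OnePoint ℝ)) =
            if 2 * x - 1 = 0 then (OnePoint.infty : OnePoint ℝ)
            else ((x / (1 - 2 * x) : ℝ) : OnePoint ℝ) := by
        split_ifs
        · exact H_one_infty
        · rw [H_one_coe, ← div_neg, neg_sub]
      rw [hx₂] at hα₂
      obtain ⟨-, hm₂, -⟩ := isDeltaExpr_iff_tail.1 hα₂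
      simp only [zero_add, Nat.reduceAdd] at hm₂
      have hsplit₂ : α 2 = .zero ∨ α 2 = .inf := by
        cases h : α 2 <;> simp_all
      rcases hsplit₂ with h2 | h2
      · have hfirst : IsFirstZero α 2 := by
          refine ⟨⟨by norm_num, h2⟩, fun j hj => ?_⟩
          by_contra! hlt
          have hj1 : j = 1 := le_antisymm (by omega) hj.1
          simp [hj1, h1] at hj
        refine ⟨2, hfirst, ?_⟩
        have hconj := hα₂.conj
        have hval : J • (if 2 * x - 1 = 0 then (OnePoint.infty : OnePoint ℝ)
            else ((x / (1 - 2 * x) : ℝ) : OnePoint ℝ)) = ((evenMap x : ℝ) : OnePoint ℝ) := by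
          rw [h2] at hm₂
          have heq : 1 / x = 2 * ((1 : ℤ) : ℝ) + (1 / x - 2) := by push_cast; ring
          split_ifs at hm₂ ⊢ with h
          · have : 1 / x - 2 = 0 := by
              rw [sub_eq_zero, div_eq_iff hx0]; linarith
            rw [J_infty, evenMap_of_one_div_eq 1 heq (by rw [this]; simp), this, abs_zero]
          · have h₁ : 0 < 1 - 2 * x := lt_of_le_of_ne (by linarith) (fun h' => h (by linarith))
            rw [coe_mem_arc_zero, le_div_iff₀ h₁] at hm₂
            have e : 1 / (x / (1 - 2 * x)) = 1 / x - 2 := by field_simp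
            have h₃ : 1 / x ≤ 3 := by rw [div_le_iff₀ hx.1]; linarith
            rw [J_coe, if_neg (div_ne_zero hx0 h₁.ne'), e, evenMap_of_one_div_eq 1 heq
              (by rw [abs_le]; constructor <;> linarith), abs_of_nonneg (by linarith)]
        rw [hval] at hconj
        have hshift : shiftJ α 2 = fun k => sigmaJ (α (k + 1 + 1)) := by
          funext k
          rw [shiftJ, add_comm]
        rwa [hshift]
      -- The third letter is ∞, so `x / (1 - 2 * x)` lies in (0, 1] again and the induction
      -- hypothesis applies to it.
      · rw [h2] at hm₂
        have hne : 2 * x - 1 ≠ 0 := by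
          intro h
          rw [if_pos h] at hm₂
          exact infty_notMem_arc_inf hm₂
        rw [if_neg hne] at hm₂ hα₂
        have h₁ : 0 < 1 - 2 * x := lt_of_le_of_ne (by linarith) (fun h' => hne (by linarith))
        have e : 1 / (x / (1 - 2 * x)) + 2 = 1 / x := by field_simp; ring
        obtain ⟨m, hm, hexp⟩ := ih (x / (1 - 2 * x))
          ⟨div_pos hx.1 h₁, (coe_mem_arc_inf.1 hm₂).2⟩
          (by push_cast at hN; linarith) _ hα₂ h2
        refine ⟨m + 2, ⟨⟨by omega, hm.1.2⟩, fun j hj => ?_⟩, ?_⟩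
        -- The letters at indices 1 and 2 are 1 and ∞, so the first zero comes exactly two places
        -- later than in the tail.
        · have hj1 : j ≠ 1 := by
            rintro rfl
            simp [h1] at hj
          have hj2 : j ≠ 2 := by
            rintro rfl
            simp [h2] at hj
          have h1j := hj.1
          have hmem : 1 ≤ j - 2 ∧ α (j - 2 + 1 + 1) = .zero :=
            ⟨by omega, by rw [show j - 2 + 1 + 1 = j by omega]; exact hj.2⟩
          have hle : m ≤ j - 2 := hm.2 hmem
          omega
        · have hshift : shiftJ α (m + 2) = shiftJ (fun k => α (k + 1 + 1)) m := by
            funext k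
            simp only [shiftJ]
            congr 2
            omega
          rw [hshift, ← evenMap_congr e]
          exact hexp

theorem exists_isFirstZero {x : ℝ} (hx : x ∈ Ioc (0 : ℝ) 1) {α : ℕ → Letter}
    (hα : IsDeltaExpr α (x : OnePoint ℝ)) (h0 : α 0 = .inf) :
    ∃ m, IsFirstZero α m ∧ IsDeltaExpr (shiftJ α m) ((evenMap x : ℝ) : OnePoint ℝ) := by
  obtain ⟨N, hN⟩ := exists_nat_ge (1 / x)
  exact exists_isFirstZero_aux N x hx hN α hα h0

theorem psiJGraph_iff {x : ℝ} (hx : x ∈ Ioc (0 : ℝ) 1) (y : ℝ) :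
    PsiJGraph x y ↔ y = evenMap x := by
  constructor
  · rintro ⟨α, m, hα, h0, hm, hy⟩
    obtain ⟨m', hm', h'⟩ := exists_isFirstZero hx hα h0
    rw [hm.unique hm'] at hy
    exact OnePoint.coe_injective (hy.eq h')
  · rintro rfl
    obtain ⟨α, hα, h0⟩ := exists_isDeltaExpr (a := .inf) (x := (x : OnePoint ℝ))
      (coe_mem_arc_inf.2 ⟨hx.1.le, hx.2⟩)
    obtain ⟨m, hm, h⟩ := exists_isFirstZero hx hα h0
    exact ⟨α, m, hα, h0, hm, h⟩

/-- The point 0 is fixed by `H .one` and `H .inf` and lies outside `arc .zero`, so all its tails are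
0 and the letter 0 never occurs. -/
theorem letter_ne_zero_of_isDeltaExpr_zero {α : ℕ → Letter}
    (hα : IsDeltaExpr α ((0 : ℝ) : OnePoint ℝ)) (n : ℕ) : α n ≠ .zero := by
  have hfix (n : ℕ) : (prodH α n)⁻¹ • ((0 : ℝ) : OnePoint ℝ) = ((0 : ℝ) : OnePoint ℝ) ∧
      α n ≠ .zero := by
    have hne {n : ℕ} (h : (prodH α n)⁻¹ • ((0 : ℝ) : OnePoint ℝ) = ((0 : ℝ) : OnePoint ℝ)) :
        α n ≠ .zero := by
      intro h'
      have := hα.2 n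
      rw [h, h', coe_mem_arc_zero] at this
      linarith
    induction n with
    | zero => exact ⟨by simp [prodH], hne (by simp [prodH])⟩
    | succ n ih =>
      have : (prodH α (n + 1))⁻¹ • ((0 : ℝ) : OnePoint ℝ) = ((0 : ℝ) : OnePoint ℝ) := by
        rw [prodH_succ_inv_smul, ih.1]
        cases h : α n
        · exact absurd h ih.2
        · rw [H_one_coe, neg_zero]
        · rw [H_inf_coe]
          norm_num
      exact ⟨this, hne this⟩
  exact (hfix n).2

theorem psiJ_eq_evenMap {x : ℝ} (hx : x ∈ Icc (0 : ℝ) 1) : psiJ x = evenMap x := by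
  rcases hx.1.eq_or_lt with rfl | h
  -- At 0 the graph is empty, so `psiJ` takes its default value 0.
  · rw [evenMap_zero, psiJ, dif_neg]
    rintro ⟨y, α, m, hα, -, hm, -⟩
    exact letter_ne_zero_of_isDeltaExpr_zero hα m hm.1.2
  · have hx' : x ∈ Ioc (0 : ℝ) 1 := ⟨h, hx.2⟩
    have hex : ∃ y, PsiJGraph x y := ⟨evenMap x, (psiJGraph_iff hx' _).2 rfl⟩
    rw [psiJ, dif_pos hex]
    exact (psiJGraph_iff hx' _).1 hex.choose_spec

/-! ### Inverse branches of the even continued fraction map -/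

theorem evenSign_eq (t : ℝ) : evenSign t = 1 ∨ evenSign t = -1 := by
  unfold evenSign
  split_ifs <;> simp

theorem one_div_eq_evenDigit_add (t : ℝ) : 1 / t = evenDigit t + evenSign t * evenMap t := by
  rw [evenMap_eq_abs, evenSign]
  split_ifs with h
  · rw [abs_of_nonneg (by linarith)]
    ring
  · rw [abs_of_nonpos (by linarith)]
    ring

theorem irrational_evenMap {t : ℝ} (ht : Irrational t) : Irrational (evenMap t) := by
  have h : Irrational (1 / t - evenDigit t) := by
    rw [one_div]
    exact ht.inv.sub_intCast _
  rw [evenMap_eq_abs]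
  rcases abs_choice (1 / t - evenDigit t) with h' | h' <;> rw [h']
  exacts [h, h.neg]

theorem pos_lt_one_of_irrational {t : ℝ} (h : t ∈ Icc (0 : ℝ) 1) (ht : Irrational t) :
    0 < t ∧ t < 1 :=
  ⟨lt_of_le_of_ne h.1 ht.ne_zero.symm, lt_of_le_of_ne h.2 ht.ne_one⟩

theorem two_le_evenDigit {t : ℝ} (h : t ∈ Icc (0 : ℝ) 1) (ht : Irrational t) :
    2 ≤ evenDigit t := by
  obtain ⟨h0, h1⟩ := pos_lt_one_of_irrational h ht
  have h2 : 1 < 1 / t := by rwa [lt_div_iff₀ h0, one_mul]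
  have h3 := (abs_le.1 (abs_one_div_sub_evenDigit_le t)).2
  have h4 : (0 : ℝ) < evenDigit t := by linarith
  have h5 : 0 < evenDigit t := by exact_mod_cast h4
  rw [evenDigit] at h5 ⊢
  omega

/-- The inverse branch of the `n`-th iterate of `evenMap` at `x`, namely
`y ↦ 1 / (b₁ + ε₁ / (b₂ + ⋯ + εₙ₋₁ / (bₙ + εₙ y)))`. -/
def evenInv : ℕ → ℝ → ℝ → ℝ
  | 0, _, y => y
  | n + 1, x, y => 1 / (evenDigit x + evenSign x * evenInv n (evenMap x) y)

theorem one_le_evenDigit_add {x z : ℝ} (hx : x ∈ Icc (0 : ℝ) 1) (hx' : Irrational x)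
    (hz : z ∈ Icc (0 : ℝ) 1) : 1 ≤ evenDigit x + evenSign x * z := by
  have hb : (2 : ℝ) ≤ evenDigit x := by exact_mod_cast two_le_evenDigit hx hx'
  rcases evenSign_eq x with h | h <;> rw [h] <;> linarith [hz.1, hz.2]

theorem one_div_evenDigit_add_mem {x z : ℝ} (hx : x ∈ Icc (0 : ℝ) 1) (hx' : Irrational x)
    (hz : z ∈ Icc (0 : ℝ) 1) : 1 / (evenDigit x + evenSign x * z) ∈ Ioc (0 : ℝ) 1 := by
  have h := one_le_evenDigit_add hx hx' hz
  exact ⟨by positivity, by rwa [div_le_one (by linarith)]⟩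

theorem evenMap_one_div_evenDigit_add (x : ℝ) {z : ℝ} (hz : z ∈ Icc (0 : ℝ) 1) :
    evenMap (1 / (evenDigit x + evenSign x * z)) = z := by
  have h : |evenSign x * z| = z := by
    rcases evenSign_eq x with h | h <;> simp [h, abs_of_nonneg hz.1]
  rw [evenMap_of_one_div_eq (z := evenSign x * z) (round (1 / x / 2)) _ (by rw [h]; exact hz.2), h]
  rw [one_div_one_div, evenDigit]
  push_cast
  ring

/-- A distance function is continuous, so the change of nearest even integer at odd values of `1 /
x` causes no jump. -/
theorem evenMap_continuousOn : ContinuousOn evenMap (Ioc 0 1) := by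
  unfold evenMap
  refine (Metric.continuous_infDist_pt _).comp_continuousOn ?_
  exact continuousOn_const.div continuousOn_id fun x hx => hx.1.ne'

theorem evenInv_mem (n : ℕ) : ∀ {x : ℝ}, x ∈ Icc (0 : ℝ) 1 → Irrational x →
    ∀ {y : ℝ}, y ∈ Icc (0 : ℝ) 1 → evenInv n x y ∈ Icc (0 : ℝ) 1 := by
  induction n with
  | zero => exact fun _ _ _ hy => hy
  | succ n ih =>
    intro x hx hx' y hy
    exact Ioc_subset_Icc_self
      (one_div_evenDigit_add_mem hx hx' (ih (evenMap_mem x) (irrational_evenMap hx') hy))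

theorem evenMap_iterate_evenInv (n : ℕ) : ∀ {x : ℝ}, x ∈ Icc (0 : ℝ) 1 → Irrational x →
    ∀ {y : ℝ}, y ∈ Icc (0 : ℝ) 1 → evenMap^[n] (evenInv n x y) = y := by
  induction n with
  | zero => exact fun _ _ _ _ => rfl
  | succ n ih =>
    intro x hx hx' y hy
    have hx₁ := evenMap_mem x
    have hx₁' := irrational_evenMap hx'
    rw [Function.iterate_succ_apply, evenInv,
      evenMap_one_div_evenDigit_add x (evenInv_mem n hx₁ hx₁' hy), ih hx₁ hx₁' hy]

theorem evenInv_evenMap_iterate (n : ℕ) (x : ℝ) : evenInv n x (evenMap^[n] x) = x := by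
  induction n generalizing x with
  | zero => rfl
  | succ n ih =>
    rw [Function.iterate_succ_apply, evenInv, ih, ← one_div_eq_evenDigit_add, one_div_one_div]

theorem evenMap_iterate_mem (n : ℕ) {x : ℝ} (hx : x ∈ Icc (0 : ℝ) 1) :
    evenMap^[n] x ∈ Icc (0 : ℝ) 1 := by
  cases n with
  | zero => exact hx
  | succ n => rw [Function.iterate_succ_apply']; exact evenMap_mem _

theorem irrational_evenMap_iterate (n : ℕ) {x : ℝ} (hx : Irrational x) :
    Irrational (evenMap^[n] x) := by
  induction n with
  | zero => exact hx
  | succ n ih => rw [Function.iterate_succ_apply']; exact irrational_evenMap ih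

theorem continuousOn_evenInv (n : ℕ) : ∀ {x : ℝ}, x ∈ Icc (0 : ℝ) 1 → Irrational x →
    ContinuousOn (evenInv n x) (Icc 0 1) := by
  induction n with
  | zero => exact fun _ _ => continuousOn_id
  | succ n ih =>
    intro x hx hx'
    have hx₁ := evenMap_mem x
    have hx₁' := irrational_evenMap hx'
    refine continuousOn_const.div
      (continuousOn_const.add (continuousOn_const.mul (ih hx₁ hx₁'))) fun y hy => ?_
    have := one_le_evenDigit_add hx hx' (evenInv_mem n hx₁ hx₁' hy)
    positivity

theorem continuousOn_evenMap_iterate (n : ℕ) : ∀ {x : ℝ}, x ∈ Icc (0 : ℝ) 1 → Irrational x →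
    ContinuousOn evenMap^[n] (evenInv n x '' Icc 0 1) := by
  induction n with
  | zero => exact fun _ _ => continuousOn_id
  | succ n ih =>
    intro x hx hx'
    have hx₁ := evenMap_mem x
    have hx₁' := irrational_evenMap hx'
    rw [Function.iterate_succ]
    refine (ih hx₁ hx₁').comp (evenMap_continuousOn.mono ?_) ?_
    · rintro _ ⟨y, hy, rfl⟩
      exact one_div_evenDigit_add_mem hx hx' (evenInv_mem n hx₁ hx₁' hy)
    · rintro _ ⟨y, hy, rfl⟩
      rw [evenInv, evenMap_one_div_evenDigit_add x (evenInv_mem n hx₁ hx₁' hy)]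
      exact mem_image_of_mem _ hy

theorem isBranch_evenInv (n : ℕ) {x : ℝ} (hx : x ∈ Icc (0 : ℝ) 1) (hx' : Irrational x) :
    IsBranch evenMap^[n] x (evenInv n x '' Icc 0 1) := by
  refine ⟨⟨_, _, (continuousOn_evenInv n hx hx').image_Icc zero_le_one⟩, ?_, ?_,
    continuousOn_evenMap_iterate n hx hx', ?_⟩
  · rintro _ ⟨y, hy, rfl⟩
    exact evenInv_mem n hx hx' hy
  · exact ⟨_, evenMap_iterate_mem n hx, evenInv_evenMap_iterate n x⟩
  · rintro _ ⟨y, hy, rfl⟩ _ ⟨z, hz, rfl⟩ h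
    rw [evenMap_iterate_evenInv n hx hx' hy, evenMap_iterate_evenInv n hx hx' hz] at h
    rw [h]

theorem bijOn_evenMap_iterate (n : ℕ) {x : ℝ} (hx : x ∈ Icc (0 : ℝ) 1) (hx' : Irrational x) :
    BijOn evenMap^[n] (evenInv n x '' Icc 0 1) (Icc 0 1) := by
  refine ⟨?_, (isBranch_evenInv n hx hx').2.2.2.2, fun y hy => ?_⟩
  · rintro _ ⟨y, hy, rfl⟩
    rwa [evenMap_iterate_evenInv n hx hx' hy]
  · exact ⟨_, mem_image_of_mem _ hy, evenMap_iterate_evenInv n hx hx' hy⟩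

/-! ### Maximality of full branches -/

theorem mem_endpoints_of_surjOn {f : ℝ → ℝ} {u v : ℝ} (huv : u ≤ v)
    (hmono : StrictMonoOn f (Icc u v) ∨ StrictAntiOn f (Icc u v))
    (hbij : BijOn f (Icc u v) (Icc 0 1)) :
    (f u = 0 ∨ f u = 1) ∧ (f v = 0 ∨ f v = 1) := by
  obtain ⟨w, hw, hw'⟩ := hbij.surjOn (left_mem_Icc.2 (zero_le_one (α := ℝ)))
  obtain ⟨z, hz, hz'⟩ := hbij.surjOn (right_mem_Icc.2 (zero_le_one (α := ℝ)))
  have hu := left_mem_Icc.2 huv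
  have hv := right_mem_Icc.2 huv
  have hfu := hbij.mapsTo hu
  have hfv := hbij.mapsTo hv
  rcases hmono with h | h
  · have h₁ := h.monotoneOn hu hw hw.1
    have h₂ := h.monotoneOn hz hv hz.2
    exact ⟨Or.inl (by linarith [hfu.1]), Or.inr (by linarith [hfv.2])⟩
  · have h₁ := h.antitoneOn hw hv hw.2
    have h₂ := h.antitoneOn hu hz hz.1
    exact ⟨Or.inr (by linarith [hfu.2]), Or.inl (by linarith [hfv.1])⟩

/-- Suppose `S'` contains a point `z` beyond an endpoint `u` of `S`. Then `u` lies strictly between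
`z` and `x` in `S'`, where `f` is strictly monotone, so `f u` lies strictly between two values in
[0, 1]. But `f u` is 0 or 1. The hypothesis that `f x` is interior keeps `x` away from the ends of
`S`. -/
theorem IsBranch.subset_of_bijOn {f : ℝ → ℝ} {x : ℝ} {S S' : Set ℝ}
    (hf : MapsTo f (Icc 0 1) (Icc 0 1)) (hS : IsBranch f x S) (hbij : BijOn f S (Icc 0 1))
    (hx : f x ∈ Ioo (0 : ℝ) 1) (hS' : IsBranch f x S') : S' ⊆ S := by
  obtain ⟨⟨u, v, rfl⟩, -, hxS, hc, hi⟩ := hS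
  obtain ⟨⟨u', v', rfl⟩, hsub', hxS', hc', hi'⟩ := hS'
  have huv := hxS.1.trans hxS.2
  have hend := mem_endpoints_of_surjOn huv (hc.strictMonoOn_of_injOn_Icc' huv hi) hbij
  have hmono' := hc'.strictMonoOn_of_injOn_Icc' (hxS'.1.trans hxS'.2) hi'
  intro z hz
  have hfz := hf (hsub' hz)
  by_contra hzS
  rw [mem_Icc, not_and_or, not_le, not_le] at hzS
  rcases hzS with hlt | hlt
  · have hu' : u ∈ Icc u' v' := ⟨hz.1.trans hlt.le, hxS.1.trans hxS'.2⟩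
    have hne : u ≠ x := by
      rintro rfl
      rcases hend.1 with h | h <;> rw [h] at hx <;> simp at hx
    have hux : u < x := lt_of_le_of_ne hxS.1 hne
    rcases hmono' with h | h
    · have h₁ := h hz hu' hlt
      have h₂ := h hu' hxS' hux
      rcases hend.1 with h | h <;> linarith [hfz.1, hx.2]
    · have h₁ := h hz hu' hlt
      have h₂ := h hu' hxS' hux
      rcases hend.1 with h | h <;> linarith [hfz.2, hx.1]
  · have hv' : v ∈ Icc u' v' := ⟨hxS'.1.trans hxS.2, hlt.le.trans hz.2⟩
    have hne : x ≠ v := by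
      rintro rfl
      rcases hend.2 with h | h <;> rw [h] at hx <;> simp at hx
    have hxv : x < v := lt_of_le_of_ne hxS.2 hne
    rcases hmono' with h | h
    · have h₁ := h hv' hz hlt
      have h₂ := h hxS' hv' hxv
      rcases hend.2 with h | h <;> linarith [hfz.2, hx.1]
    · have h₁ := h hv' hz hlt
      have h₂ := h hxS' hv' hxv
      rcases hend.2 with h | h <;> linarith [hfz.1, hx.2]

theorem branchInterval_eq {f : ℝ → ℝ} {x : ℝ} {S : Set ℝ}
    (hS : IsBranch f x S) (hmax : ∀ S', IsBranch f x S' → S' ⊆ S) :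
    branchInterval f x = S :=
  Subset.antisymm (sUnion_subset hmax) (subset_sUnion_of_mem hS)

theorem IsBranch.congr {f g : ℝ → ℝ} (hfg : EqOn f g (Icc 0 1)) {x : ℝ} {S : Set ℝ}
    (h : IsBranch f x S) : IsBranch g x S :=
  ⟨h.1, h.2.1, h.2.2.1, h.2.2.2.1.congr (hfg.symm.mono h.2.1),
    h.2.2.2.2.congr (hfg.mono h.2.1)⟩

theorem psiJ_iterate_eqOn (n : ℕ) : EqOn psiJ^[n] evenMap^[n] (Icc 0 1) := by
  intro x hx
  induction n with
  | zero => rfl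
  | succ n ih =>
    rw [Function.iterate_succ_apply', Function.iterate_succ_apply', ih,
      psiJ_eq_evenMap (evenMap_iterate_mem n hx)]

theorem isBranch_psiJ (n : ℕ) {x : ℝ} (hx : x ∈ Icc (0 : ℝ) 1) (hx' : Irrational x) :
    IsBranch psiJ^[n] x (evenInv n x '' Icc 0 1) :=
  (isBranch_evenInv n hx hx').congr (psiJ_iterate_eqOn n).symm

theorem bijOn_psiJ_iterate (n : ℕ) {x : ℝ} (hx : x ∈ Icc (0 : ℝ) 1) (hx' : Irrational x) :
    BijOn psiJ^[n] (evenInv n x '' Icc 0 1) (Icc 0 1) :=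
  (bijOn_evenMap_iterate n hx hx').congr
    ((psiJ_iterate_eqOn n).symm.mono (isBranch_evenInv n hx hx').2.1)

theorem branchInterval_psiJ (n : ℕ) {x : ℝ} (hx : x ∈ Icc (0 : ℝ) 1) (hx' : Irrational x) :
    branchInterval psiJ^[n] x = evenInv n x '' Icc 0 1 := by
  refine branchInterval_eq (isBranch_psiJ n hx hx') fun S' hS' => ?_
  refine (isBranch_psiJ n hx hx').subset_of_bijOn ?_ (bijOn_psiJ_iterate n hx hx') ?_ hS'
  · intro y hy
    rw [psiJ_iterate_eqOn n hy]
    exact evenMap_iterate_mem n hy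
  · rw [psiJ_iterate_eqOn n hx]
    exact pos_lt_one_of_irrational (evenMap_iterate_mem n hx) (irrational_evenMap_iterate n hx')

theorem isGreatest_branchInterval_psiJ (n : ℕ) {x : ℝ} (hx : x ∈ Icc (0 : ℝ) 1)
    (hx' : Irrational x) :
    IsGreatest {S | IsBranch psiJ^[n] x S} (branchInterval psiJ^[n] x) := by
  refine ⟨?_, fun S hS => subset_sUnion_of_mem hS⟩
  rw [branchInterval_psiJ n hx hx']
  exact isBranch_psiJ n hx hx'

theorem psiJInv_eq (n : ℕ) {x : ℝ} (hx : x ∈ Icc (0 : ℝ) 1) (hx' : Irrational x)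
    {y : ℝ} (hy : y ∈ Icc (0 : ℝ) 1) : psiJInv x n y = evenInv n x y := by
  have hmem : evenInv n x y ∈ evenInv n x '' Icc 0 1 := mem_image_of_mem _ hy
  have h := (bijOn_psiJ_iterate n hx hx').injOn.leftInvOn_invFunOn hmem
  rwa [psiJ_iterate_eqOn n (evenInv_mem n hx hx' hy), evenMap_iterate_evenInv n hx hx' hy,
    ← branchInterval_psiJ n hx hx'] at h

/-! ### Convergents -/

/-- The entering sign is the first partial numerator, hence a factor of the whole truncation;
leaving it free lets the induction run. Irrationality keeps the algorithm from stopping. -/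
theorem convs'Aux_corec_evenStep (n : ℕ) : ∀ (s : ℝ) {x : ℝ}, Irrational x →
    GenContFract.convs'Aux (Stream'.Seq.corec evenStep (s, x)) n = s * evenInv n x 0 := by
  induction n with
  | zero => intro s x _; simp [GenContFract.convs'Aux, evenInv]
  | succ n ih =>
    intro s x hx
    have h : Stream'.Seq.corec evenStep (s, x) =
        Stream'.Seq.cons ⟨s, evenDigit x⟩ (Stream'.Seq.corec evenStep (evenSign x, evenMap x)) := by
      apply Stream'.Seq.destruct_eq_cons
      rw [Stream'.Seq.corec_eq, evenStep, if_neg hx.ne_zero]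
      rfl
    rw [h]
    simp only [GenContFract.convs'Aux, Stream'.Seq.head_cons, Stream'.Seq.tail_cons]
    rw [ih _ (irrational_evenMap hx), evenInv, mul_one_div]

theorem evenConvergent_eq (n : ℕ) {x : ℝ} (hx : Irrational x) :
    evenConvergent x n = evenInv n x 0 := by
  simp [evenConvergent, evenContFract, GenContFract.convs', convs'Aux_corec_evenStep n 1 hx]

/-! ### Numerators and denominators of the convergents -/

/-- The sign `evenSign t` as an integer. -/
def evenSignInt (t : ℝ) : ℤ := if (evenDigit t : ℝ) ≤ 1 / t then 1 else -1

theorem cast_evenSignInt (t : ℝ) : (evenSignInt t : ℝ) = evenSign t := by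
  unfold evenSignInt evenSign
  split_ifs <;> simp

theorem evenSignInt_eq (t : ℝ) : evenSignInt t = 1 ∨ evenSignInt t = -1 := by
  unfold evenSignInt
  split_ifs <;> simp

/-- Numerator and denominator of the `n`-th even continued fraction convergent. -/
def evenFrac : ℕ → ℝ → ℤ × ℤ
  | 0, _ => (0, 1)
  | n + 1, x => ((evenFrac n (evenMap x)).2,
      evenDigit x * (evenFrac n (evenMap x)).2 + evenSignInt x * (evenFrac n (evenMap x)).1)

theorem evenFrac_succ (n : ℕ) (x : ℝ) :
    evenFrac (n + 1) x = ((evenFrac n (evenMap x)).2,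
      evenDigit x * (evenFrac n (evenMap x)).2 + evenSignInt x * (evenFrac n (evenMap x)).1) :=
  rfl

theorem evenFrac_bounds (n : ℕ) : ∀ {x : ℝ}, x ∈ Icc (0 : ℝ) 1 → Irrational x →
    0 ≤ (evenFrac n x).1 ∧ (evenFrac n x).1 ≤ (evenFrac n x).2 ∧ 0 < (evenFrac n x).2 := by
  induction n with
  | zero => intro x _ _; simp [evenFrac]
  | succ n ih =>
    intro x hx hx'
    obtain ⟨h₁, h₂, h₃⟩ := ih (evenMap_mem x) (irrational_evenMap hx')
    have hb := mul_le_mul_of_nonneg_right (two_le_evenDigit hx hx') h₃.le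
    simp only [evenFrac]
    rcases evenSignInt_eq x with h | h <;> rw [h] <;> refine ⟨h₃.le, ?_, ?_⟩ <;> linarith

/-- The recursion is linear, so the differences of consecutive pairs obey it too and stay in the
cone `0 ≤ p ≤ q`, `0 < q`, as in `evenFrac_bounds`. In particular the denominators strictly
increase. -/
theorem evenFrac_increments (n : ℕ) : ∀ {x : ℝ}, x ∈ Icc (0 : ℝ) 1 → Irrational x →
    0 ≤ (evenFrac (n + 1) x).1 - (evenFrac n x).1 ∧
    (evenFrac (n + 1) x).1 - (evenFrac n x).1 ≤ (evenFrac (n + 1) x).2 - (evenFrac n x).2 ∧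
    0 < (evenFrac (n + 1) x).2 - (evenFrac n x).2 := by
  induction n with
  | zero =>
    intro x hx hx'
    have hb := two_le_evenDigit hx hx'
    simp only [evenFrac]
    refine ⟨by norm_num, ?_, ?_⟩ <;> linarith
  | succ n ih =>
    intro x hx hx'
    obtain ⟨h₁, h₂, h₃⟩ := ih (evenMap_mem x) (irrational_evenMap hx')
    have hb := mul_le_mul_of_nonneg_right (two_le_evenDigit hx hx') h₃.le
    rw [evenFrac_succ (n + 1), evenFrac_succ n x]
    rcases evenSignInt_eq x with h | h <;> rw [h] <;> refine ⟨h₃.le, ?_, ?_⟩ <;> linarith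

/-- Each step of the recursion applies a matrix of determinant `-ε`; squaring avoids tracking the
sign. -/
theorem evenFrac_det (n : ℕ) : ∀ x : ℝ,
    ((evenFrac n x).1 * (evenFrac (n + 1) x).2 - (evenFrac (n + 1) x).1 * (evenFrac n x).2) ^ 2
      = 1 := by
  induction n with
  | zero => intro x; simp [evenFrac]
  | succ n ih =>
    intro x
    have h := ih (evenMap x)
    have hs : evenSignInt x ^ 2 = 1 := by rcases evenSignInt_eq x with h | h <;> simp [h]
    rw [evenFrac_succ (n + 1), evenFrac_succ n x]
    linear_combination h + (((evenFrac n (evenMap x)).1 * (evenFrac (n + 1) (evenMap x)).2 -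
      (evenFrac (n + 1) (evenMap x)).1 * (evenFrac n (evenMap x)).2) ^ 2) * hs

/-- The digit is even, so modulo 2 a step merely swaps numerator and denominator. -/
theorem evenFrac_odd (n : ℕ) : ∀ x : ℝ, Odd ((evenFrac n x).1 + (evenFrac n x).2) := by
  induction n with
  | zero => intro x; simp [evenFrac]
  | succ n ih =>
    intro x
    obtain ⟨k, hk⟩ := ih (evenMap x)
    simp only [evenFrac, evenDigit]
    rcases evenSignInt_eq x with h | h <;> rw [h]
    · exact ⟨round (1 / x / 2) * (evenFrac n (evenMap x)).2 + k, by linear_combination hk⟩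
    · exact ⟨round (1 / x / 2) * (evenFrac n (evenMap x)).2 + k - (evenFrac n (evenMap x)).1,
        by linear_combination hk⟩

theorem evenInv_zero_eq (n : ℕ) : ∀ {x : ℝ}, x ∈ Icc (0 : ℝ) 1 → Irrational x →
    evenInv n x 0 = (evenFrac n x).1 / (evenFrac n x).2 := by
  induction n with
  | zero => intro x _ _; simp [evenInv, evenFrac]
  | succ n ih =>
    intro x hx hx'
    have hq : ((evenFrac n (evenMap x)).2 : ℝ) ≠ 0 := by
      exact_mod_cast (evenFrac_bounds n (evenMap_mem x) (irrational_evenMap hx')).2.2.ne'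
    simp only [evenInv, evenFrac]
    rw [ih (evenMap_mem x) (irrational_evenMap hx')]
    push_cast
    rw [cast_evenSignInt, one_div, ← inv_div]
    field_simp

theorem evenFrac_error_succ (n : ℕ) {x : ℝ} (hx : x ≠ 0) :
    (evenFrac (n + 1) x).2 * x - (evenFrac (n + 1) x).1 =
      -evenSign x * x * ((evenFrac n (evenMap x)).2 * evenMap x - (evenFrac n (evenMap x)).1) := by
  have h := one_div_eq_evenDigit_add x
  rw [div_eq_iff hx] at h
  simp only [evenFrac]
  push_cast
  rw [cast_evenSignInt]
  linear_combination (-((evenFrac n (evenMap x)).2 : ℝ)) * h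

theorem abs_evenFrac_error_succ (n : ℕ) {x : ℝ} (hx : 0 < x) :
    |(evenFrac (n + 1) x).2 * x - (evenFrac (n + 1) x).1| =
      x * |(evenFrac n (evenMap x)).2 * evenMap x - (evenFrac n (evenMap x)).1| := by
  rw [evenFrac_error_succ n hx.ne', abs_mul, abs_mul, abs_of_pos hx]
  rcases evenSign_eq x with h | h <;> simp [h]

/-- Passing from `evenMap x` to `x` multiplies both errors by `x`, which reduces the claim to the
first two convergents, with errors `x` and `x * evenMap x`. -/
theorem abs_evenFrac_error_lt (n : ℕ) : ∀ {x : ℝ}, x ∈ Icc (0 : ℝ) 1 → Irrational x →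
    |(evenFrac (n + 1) x).2 * x - (evenFrac (n + 1) x).1| <
      |(evenFrac n x).2 * x - (evenFrac n x).1| := by
  induction n with
  | zero =>
    intro x hx hx'
    obtain ⟨h0, h1⟩ := pos_lt_one_of_irrational hx hx'
    obtain ⟨h2, h3⟩ := pos_lt_one_of_irrational (evenMap_mem x) (irrational_evenMap hx')
    rw [abs_evenFrac_error_succ 0 h0]
    simp only [evenFrac, Int.cast_one, one_mul, Int.cast_zero, sub_zero]
    rw [abs_of_pos h0, abs_of_pos h2]
    exact mul_lt_of_lt_one_right h0 h3
  | succ n ih =>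
    intro x hx hx'
    obtain ⟨h0, h1⟩ := pos_lt_one_of_irrational hx hx'
    rw [abs_evenFrac_error_succ _ h0, abs_evenFrac_error_succ _ h0]
    exact mul_lt_mul_of_pos_left (ih (evenMap_mem x) (irrational_evenMap hx')) h0

/-! ### Best approximation -/

theorem abs_error_lt_of_unimodular {p q p' q' a b : ℤ} {x : ℝ}
    (hdet : (p * q' - p' * q) ^ 2 = 1) (hq : 0 < q) (hqq' : q < q')
    (hpq : Odd (p + q)) (hpq' : Odd (p' + q')) (hab : Odd (a + b)) (hcop : IsCoprime a b)
    (hb : 0 < b) (hbq' : b < q') (hne : ¬(a = p ∧ b = q))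
    (herr : |q' * x - p'| < |q * x - p|) :
    |q * x - p| < |b * x - a| := by
  obtain ⟨u, v, ha, hb'⟩ : ∃ u v : ℤ, a = u * p + v * p' ∧ b = u * q + v * q' :=
    -- Cramer's rule: the determinant is its own inverse.
    ⟨(p * q' - p' * q) * (a * q' - b * p'), (p * q' - p' * q) * (b * p - a * q),
      by linear_combination (-a) * hdet, by linear_combination (-b) * hdet⟩
  have hparity : Odd (u + v) := by
    obtain ⟨k, hk⟩ := hpq
    obtain ⟨l, hl⟩ := hpq'
    obtain ⟨m, hm⟩ := hab
    exact ⟨m - u * k - v * l, by linear_combination hm - ha - hb' - u * hk - v * hl⟩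
  -- If `v = 0`, coprimality makes `u` a unit: `u = 1` is the excluded fraction and `u = -1` has
  -- negative denominator.
  have hv : v ≠ 0 := by
    rintro rfl
    have hu : IsUnit u := hcop.isUnit_of_dvd' ⟨p, by linear_combination ha⟩
      ⟨q, by linear_combination hb'⟩
    rcases Int.isUnit_iff.1 hu with rfl | rfl
    · exact hne ⟨by linear_combination ha, by linear_combination hb'⟩
    · linarith
  -- From `0 < b < q'` and `0 < q < q'`, the coefficients have opposite signs and `|v| ≤ |u|`; since
  -- `u + v` is odd, equality is impossible.
  have huv : |v| + 1 ≤ |u| := by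
    have hle : |v| ≤ |u| := by
      rcases lt_or_gt_of_ne hv with h | h
      · have : 0 < u := by
          by_contra! h'
          nlinarith
        rw [abs_of_neg h, abs_of_pos this]
        by_contra! h'
        nlinarith
      · have : u < 0 := by
          by_contra! h'
          nlinarith
        rw [abs_of_pos h, abs_of_neg this]
        by_contra! h'
        nlinarith
    refine lt_of_le_of_ne hle fun h => ?_
    obtain ⟨k, hk⟩ := hparity
    rcases abs_eq_abs.1 h with h | h <;> omega
  have huv' : (|(v : ℝ)| + 1) ≤ |(u : ℝ)| := by exact_mod_cast huv
  have hv' : 0 < |(v : ℝ)| := by positivity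
  have hsum : (b : ℝ) * x - a = u * (q * x - p) + v * (q' * x - p') := by
    rw [ha, hb']
    push_cast
    ring
  have htri : |(u : ℝ)| * |q * x - p| ≤ |(b : ℝ) * x - a| + |(v : ℝ)| * |q' * x - p'| := by
    rw [hsum, ← abs_mul, ← abs_mul]
    have := abs_sub (u * (q * x - p) + v * (q' * x - p')) (v * (q' * x - p'))
    rwa [add_sub_cancel_right] at this
  have h₁ := mul_lt_mul_of_pos_left herr hv'
  have h₂ := mul_le_mul_of_nonneg_right huv' (abs_nonneg ((q : ℝ) * x - p))
  linarith

theorem mem_ratClass_zero_union_inf (r : ℚ) :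
    r ∈ ratClass .zero ∪ ratClass .inf ↔ Odd (r.num + (r.den : ℤ)) := by
  have h : r ∈ ratClass .zero ∪ ratClass .inf ↔
      (Even r.num ∧ Odd r.den) ∨ (Odd r.num ∧ Even r.den) := Iff.rfl
  rw [h, Int.odd_add, Int.even_coe_nat, ← Int.not_even_iff_odd, ← Nat.not_even_iff_odd]
  tauto

/-- The `n`-th even continued fraction convergent as a rational number. -/
def evenRat (n : ℕ) (x : ℝ) : ℚ := (evenFrac n x).1 / (evenFrac n x).2

theorem evenFrac_isCoprime (n : ℕ) (x : ℝ) : IsCoprime (evenFrac n x).1 (evenFrac n x).2 := by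
  have h := evenFrac_det n x
  exact ⟨((evenFrac n x).1 * (evenFrac (n + 1) x).2 - (evenFrac (n + 1) x).1 * (evenFrac n x).2) *
      (evenFrac (n + 1) x).2,
    -((evenFrac n x).1 * (evenFrac (n + 1) x).2 - (evenFrac (n + 1) x).1 * (evenFrac n x).2) *
      (evenFrac (n + 1) x).1, by linear_combination h⟩

theorem evenRat_num (n : ℕ) {x : ℝ} (hx : x ∈ Icc (0 : ℝ) 1) (hx' : Irrational x) :
    (evenRat n x).num = (evenFrac n x).1 :=
  Rat.num_div_eq_of_coprime (evenFrac_bounds n hx hx').2.2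
    (Int.isCoprime_iff_gcd_eq_one.1 (evenFrac_isCoprime n x))

theorem evenRat_den (n : ℕ) {x : ℝ} (hx : x ∈ Icc (0 : ℝ) 1) (hx' : Irrational x) :
    ((evenRat n x).den : ℤ) = (evenFrac n x).2 :=
  Rat.den_div_eq_of_coprime (evenFrac_bounds n hx hx').2.2
    (Int.isCoprime_iff_gcd_eq_one.1 (evenFrac_isCoprime n x))

theorem evenRat_mem_ratClass (n : ℕ) {x : ℝ} (hx : x ∈ Icc (0 : ℝ) 1) (hx' : Irrational x) :
    evenRat n x ∈ ratClass .zero ∪ ratClass .inf := by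
  rw [mem_ratClass_zero_union_inf, evenRat_num n hx hx', evenRat_den n hx hx']
  exact evenFrac_odd n x

theorem cast_evenRat (n : ℕ) {x : ℝ} (hx : x ∈ Icc (0 : ℝ) 1) (hx' : Irrational x) :
    (evenRat n x : ℝ) = evenConvergent x n := by
  rw [evenConvergent_eq n hx', evenInv_zero_eq n hx hx', evenRat]
  push_cast
  rfl

/-- The range of denominators reaches up to the next convergent, beyond what a best approximation
requires; the converse `exists_evenRat_of_mem_bestApprox` needs the surplus. -/
theorem abs_evenRat_error_lt (n : ℕ) {x : ℝ} (hx : x ∈ Icc (0 : ℝ) 1) (hx' : Irrational x)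
    {s : ℚ} (hs : s ∈ ratClass .zero ∪ ratClass .inf) (hne : s ≠ evenRat n x)
    (hden : (s.den : ℤ) < (evenFrac (n + 1) x).2) :
    |((evenRat n x).den : ℝ) * x - (evenRat n x).num| < |(s.den : ℝ) * x - s.num| := by
  have hn := evenRat_num n hx hx'
  have hd := evenRat_den n hx hx'
  have h := abs_error_lt_of_unimodular (a := s.num) (b := s.den) (evenFrac_det n x)
    (evenFrac_bounds n hx hx').2.2 (sub_pos.1 (evenFrac_increments n hx hx').2.2)
    (evenFrac_odd n x) (evenFrac_odd (n + 1) x) ((mem_ratClass_zero_union_inf s).1 hs)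
    (Int.isCoprime_iff_gcd_eq_one.2 s.reduced) (by exact_mod_cast s.den_pos) hden
    (fun h => hne (Rat.ext (h.1.trans hn.symm) (by exact_mod_cast h.2.trans hd.symm)))
    (abs_evenFrac_error_lt n hx hx')
  rw [← hn, ← hd] at h
  exact_mod_cast h

theorem evenRat_mem_bestApprox (n : ℕ) {x : ℝ} (hx : x ∈ Icc (0 : ℝ) 1) (hx' : Irrational x) :
    evenRat n x ∈ bestApprox .zero .inf x := by
  refine ⟨evenRat_mem_ratClass n hx hx', fun s hs hne hden => ?_⟩
  refine abs_evenRat_error_lt n hx hx' hs hne ?_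
  have h : (s.den : ℤ) ≤ (evenRat n x).den := by exact_mod_cast hden
  rw [evenRat_den n hx hx'] at h
  exact h.trans_lt (sub_pos.1 (evenFrac_increments n hx hx').2.2)

theorem natCast_lt_evenFrac_den (n : ℕ) {x : ℝ} (hx : x ∈ Icc (0 : ℝ) 1) (hx' : Irrational x) :
    (n : ℤ) < (evenFrac n x).2 := by
  induction n with
  | zero => simp [evenFrac]
  | succ n ih =>
    have := (evenFrac_increments n hx hx').2.2
    push_cast
    omega

theorem exists_evenFrac_den_bracket {b : ℕ} (hb : 0 < b) {x : ℝ} (hx : x ∈ Icc (0 : ℝ) 1)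
    (hx' : Irrational x) : ∃ n, (evenFrac n x).2 ≤ b ∧ (b : ℤ) < (evenFrac (n + 1) x).2 := by
  classical
  have hex : ∃ n, (b : ℤ) < (evenFrac n x).2 := ⟨b, natCast_lt_evenFrac_den b hx hx'⟩
  have hspec := Nat.find_spec hex
  have hmin := fun m => Nat.find_min hex (m := m)
  cases h : Nat.find hex with
  | zero =>
    rw [h] at hspec
    simp only [evenFrac] at hspec
    omega
  | succ n =>
    rw [h] at hspec hmin
    exact ⟨n, not_lt.1 (hmin n n.lt_succ_self), hspec⟩

theorem exists_evenRat_of_mem_bestApprox {x : ℝ} (hx : x ∈ Icc (0 : ℝ) 1) (hx' : Irrational x)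
    {r : ℚ} (hr : r ∈ bestApprox .zero .inf x) : ∃ n, r = evenRat n x := by
  obtain ⟨n, hn, hn'⟩ := exists_evenFrac_den_bracket r.den_pos hx hx'
  refine ⟨n, ?_⟩
  by_contra hne
  rw [← evenRat_den n hx hx'] at hn
  -- The denominator of `r` lies between those of two consecutive convergents. If `r` were not the
  -- lower one, each of the two would have strictly smaller error than the other.
  exact lt_asymm (abs_evenRat_error_lt n hx hx' hr.1 hne hn')
    (hr.2 _ (evenRat_mem_ratClass n hx hx') (Ne.symm hne) (by exact_mod_cast hn))

theorem image_bestApprox_eq_range {x : ℝ} (hx : x ∈ Icc (0 : ℝ) 1) (hx' : Irrational x) :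
    (fun r : ℚ => (r : ℝ)) '' bestApprox .zero .inf x = range (evenConvergent x) := by
  ext y
  constructor
  · rintro ⟨r, hr, rfl⟩
    obtain ⟨n, rfl⟩ := exists_evenRat_of_mem_bestApprox hx hx' hr
    exact ⟨n, (cast_evenRat n hx hx').symm⟩
  · rintro ⟨n, rfl⟩
    exact ⟨_, evenRat_mem_bestApprox n hx hx', cast_evenRat n hx hx'⟩

theorem psiJInv_zero (n : ℕ) {x : ℝ} (hx : x ∈ Icc (0 : ℝ) 1) (hx' : Irrational x) :
    psiJInv x n 0 = evenConvergent x n := by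
  rw [psiJInv_eq n hx hx' (left_mem_Icc.2 zero_le_one), evenConvergent_eq n hx']

end DeltaCF

end

open DeltaCF in
theorem mainTheorem5 :
    (∀ x ∈ Ioc (0 : ℝ) 1,
      (∃ α : ℕ → Letter, IsDeltaExpr α (x : OnePoint ℝ) ∧ α 0 = Letter.inf) ∧
      ∀ α : ℕ → Letter, IsDeltaExpr α (x : OnePoint ℝ) → α 0 = Letter.inf →
        ∃ m : ℕ, IsFirstZero α m ∧
          ∀ y : OnePoint ℝ, IsDeltaExpr (shiftJ α m) y ↔ y = ((psiJ x : ℝ) : OnePoint ℝ)) ∧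
    EqOn psiJ evenMap (Icc 0 1) ∧
    (∀ x ∈ Icc (0 : ℝ) 1, Irrational x →
      (∀ i : ℕ,
        IsGreatest {S | IsBranch psiJ^[i] x S} (branchInterval psiJ^[i] x) ∧
        BijOn psiJ^[i] (branchInterval psiJ^[i] x) (Icc 0 1) ∧
        psiJInv x i 0 = evenConvergent x i) ∧
      (fun r : ℚ => (r : ℝ)) '' bestApprox Letter.zero Letter.inf x =
        range (fun i : ℕ => psiJInv x i 0) ∧
      (fun r : ℚ => (r : ℝ)) '' bestApprox Letter.zero Letter.inf x =
        range (evenConvergent x)) := by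
  refine ⟨fun x hx => ⟨exists_isDeltaExpr (coe_mem_arc_inf.2 ⟨hx.1.le, hx.2⟩), fun α hα h0 => ?_⟩,
    fun x hx => psiJ_eq_evenMap hx, fun x hx hx' => ⟨fun i =>
      ⟨isGreatest_branchInterval_psiJ i hx hx', ?_, psiJInv_zero i hx hx'⟩, ?_, image_bestApprox_eq_range hx hx'⟩⟩
  · obtain ⟨m, hm, h⟩ := exists_isFirstZero hx hα h0
    rw [psiJ_eq_evenMap ⟨hx.1.le, hx.2⟩]
    exact ⟨m, hm, fun y => ⟨fun hy => hy.eq h, fun hy => hy ▸ h⟩⟩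
  · rw [branchInterval_psiJ i hx hx']
    exact bijOn_psiJ_iterate i hx hx'
  · simp only [psiJInv_zero _ hx hx']
    exact image_bestApprox_eq_range hx hx'
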